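/- Let $\mathbb F$ be a field, $d\ge 0$, and for $(\alpha,a)\in\mathbb F^{d}\times\mathbb F=\mathbb F^{d+1}$ put $H_{\alpha,a}=\{x\in\mathbb F^d:\alpha\cdot x=a\}$. Let $\mathcal A=\{H_{\alpha_i,a_i}: 1\le i\le m\}$ be an arrangement of hyperplanes in $\mathbb F^d$ ($\alpha_i\ne 0$ for all $i$) that is essential, i.e. $\alpha_1,\dots,\alpha_m$ span $\mathbb F^d$. For a finite collection $\mathcal B$ of subsets of $V=\mathbb F^n$, each defined by one equation $\beta\cdot x=b$, let $L(\mathcal B)$ be the set of all nonempty intersections of members of $\mathcal B$ (including $V$), ordered by reverse inclusion, with Möbius function $\mu$. For $X\in L(\mathcal B)$ let $\mathcal B/X=\{H\cap X : H\in\mathcal B,\ X\not\subseteq H,\ H\cap X\neq\emptyset\}$ and $M(\mathcal B/X)=X\setminus\bigcup_{K\in\mathcal B/X}K$, and let $M(\mathcal B)=V\setminus\bigcup_{H\in\mathcal B}H$. Each $x\in V$ lies in $M(\mathcal B/X)$ for exactly one $X\in L(\mathcal B)$, denoted $X_x$. Let $\mathcal A^o=\{H_{\alpha_i,0}\}$.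 The induced adjoint arrangement $\tilde{\mathcal A}$ consists of the hyperplanes in $\mathbb F^{d+1}$ through the origin with normal vectors $(v,-1)$, for the $0$-dimensional members $\{v\}$ of $L(\mathcal A)$, and $(u,0)$, for the $1$-dimensional members $\mathbb F u$ of $L(\mathcal A^o)$. For $\mathcal B$ in $\mathbb F^d$ define integers $c_{ij}(\mathcal B)$ $(0\le j\le i\le d)$ and $w_k^+(\mathcal B)$ $(0\le k\le d)$ by $$\sum_{X\le Y\text{ in }L(\mathcal B)}\mu(X,Y)s^{d-\dim X}t^{\dim Y}=\sum_{0\le j\le i\le d}(-1)^jc_{ij}(\mathcal B)s^{d-i}t^{i-j},\qquad \sum_{X\in L(\mathcal B)}\mu(V,X)t^{\dim X}=\sum_{k=0}^d(-1)^kw_k^+(\mathcal B)t^{d-k},$$ except that all $c_{ij}(\mathcal B)$ and $w^+_k(\mathcal B)$ are $0$ if $V\in\mathcal B$. Let $W_k(\mathcal B)$ be the number of members of $L(\mathcal B)$ of codimension $k$. If $\mathbb F=\mathbb R$, let $r(\mathcal B)$ be the number of connected components of $M(\mathcal B)$, and $f_k(\mathcal B)$ the number of $k$-dimensional faces, i.e.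 of connected components of the sets $M(\mathcal B/X)$ with $X\in L(\mathcal B)$, $\dim X=k$. For $(\alpha,a)\in\mathbb F^{d+1}$ write $\mathcal A+H_{\alpha,a}=\mathcal A\cup\{H_{\alpha,a}\}$. Let $(\alpha,a),(\alpha',a')\in\mathbb F^{d+1}$ satisfy $X_{(\alpha,a)}\subseteq X_{(\alpha',a')}$ in $L(\tilde{\mathcal A})$. Then $$c_{ij}(\mathcal A+H_{\alpha,a})\le c_{ij}(\mathcal A+H_{\alpha',a'})\qquad(0\le j\le i\le d),$$ $$w_i^+(\mathcal A+H_{\alpha,a})\le w_i^+(\mathcal A+H_{\alpha',a'}),\qquad W_i(\mathcal A+H_{\alpha,a})\le W_i(\mathcal A+H_{\alpha',a'})\qquad(0\le i\le d),$$ and, if $\mathbb F=\mathbb R$, also $$f_i(\mathcal A+H_{\alpha,a})\le f_i(\mathcal A+H_{\alpha',a'})\quad(0\le i\le d),\qquad r(\mathcal A+H_{\alpha,a})\le r(\mathcal A+H_{\alpha',a'}).$$ -/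

import Mathlib

open scoped Polynomial

namespace HypArr

/-- The solution set `H_{α,a}` of `α · x = a` in `F^d`. It is a hyperplane when `α ≠ 0`; it is the
whole space for `(α, a) = (0, 0)` and empty for `α = 0`, `a ≠ 0`. -/
def hyperplane {F : Type*} [Field F] {d : ℕ} (α : Fin d → F) (a : F) : Set (Fin d → F) :=
  {x | α ⬝ᵥ x = a}

/-- The arrangement `{H_{β_i,b_i} | i ∈ [m]}`. -/
abbrev arrangement {F : Type*} [Field F] {d m : ℕ} (β : Fin m → Fin d → F) (b : Fin m → F) :
    Set (Set (Fin d → F)) :=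
  Set.range fun i => hyperplane (β i) (b i)

/-- The one-element extension `𝒜 + H_{α,a}`. -/
abbrev extension {F : Type*} [Field F] {d : ℕ} (𝒜 : Set (Set (Fin d → F)))
    (α : Fin d → F) (a : F) : Set (Set (Fin d → F)) :=
  insert (hyperplane α a) 𝒜

/-- The intersection semi-lattice `L(𝒜)`: all nonempty intersections of members of `𝒜`,
including the whole space (the intersection of the empty subfamily). -/
def L {V : Type*} (𝒜 : Set (Set V)) : Set (Set V) :=
  {X | X.Nonempty ∧ ∃ ℬ ⊆ 𝒜, X = ⋂₀ ℬ}

instance {V : Type*} (𝒜 : Set (Set V)) [Finite 𝒜] : Finite (L 𝒜) := by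
  have h : (𝒜.powerset).Finite := (Set.toFinite 𝒜).powerset
  refine ((h.image fun ℬ => ⋂₀ ℬ).subset ?_).to_subtype
  rintro X ⟨-, ℬ, hℬ, rfl⟩
  exact ⟨ℬ, hℬ, rfl⟩

/-- The dimension of a (nonempty) affine subspace of `F^d`. -/
noncomputable def dim {F : Type*} [Field F] {d : ℕ} (X : Set (Fin d → F)) : ℕ :=
  Module.finrank F (vectorSpan F X)

/-- The localization `𝒜_X = {H ∈ 𝒜 | X ⊆ H}`. -/
def localization {V : Type*} (𝒜 : Set (Set V)) (X : Set V) : Set (Set V) :=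
  {H | H ∈ 𝒜 ∧ X ⊆ H}

/-- The restriction `𝒜/X = {H ∩ X ≠ ∅ | H ∈ 𝒜 \ 𝒜_X}`, an arrangement in `X`. -/
def restriction {V : Type*} (𝒜 : Set (Set V)) (X : Set V) : Set (Set V) :=
  {K | ∃ H ∈ 𝒜 \ localization 𝒜 X, K = H ∩ X ∧ K.Nonempty}

/-- The complement `M(ℬ) = X \ ⋃_{H ∈ ℬ} H` of an arrangement `ℬ` in the ambient space `X`. -/
def complement {V : Type*} (X : Set V) (ℬ : Set (Set V)) : Set V :=
  X \ ⋃₀ ℬ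

/-- The Möbius function `μ(X, Y)` of `L(𝒜)` ordered by reverse inclusion. -/
noncomputable def mobius {V : Type*} (𝒜 : Set (Set V)) [Finite 𝒜] (X Y : L 𝒜) : ℤ := by
  classical
  letI : Fintype (L 𝒜)ᵒᵈ := Fintype.ofFinite _
  letI : LocallyFiniteOrder (L 𝒜)ᵒᵈ := Fintype.toLocallyFiniteOrder
  exact IncidenceAlgebra.mu ℤ (OrderDual.toDual X) (OrderDual.toDual Y)

open Classical in
/-- The characteristic polynomial `χ(𝒜, t) = ∑_{X ∈ L(𝒜)} μ(V, X) t^{dim X}`, with `χ(𝒜, t) = 0`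
when the ambient space `V = F^d` is a member of `𝒜`. -/
noncomputable def charPoly {F : Type*} [Field F] {d : ℕ} (𝒜 : Set (Set (Fin d → F)))
    [Finite 𝒜] : ℤ[X] :=
  letI : Fintype (L 𝒜) := Fintype.ofFinite _
  if Set.univ ∈ 𝒜 then 0
  else ∑ X : L 𝒜,
    Polynomial.C (mobius 𝒜 ⟨Set.univ, Set.univ_nonempty, ∅, Set.empty_subset _, by simp⟩ X) *
      Polynomial.X ^ dim (X : Set (Fin d → F))

open Classical in
/-- The Whitney polynomial `w(𝒜; s, t) = ∑_{X ≤ Y} μ(X, Y) s^{d - dim X} t^{dim Y}`, with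
`w(𝒜; s, t) = 0` when the ambient space is a member of `𝒜`. The outer variable of `ℤ[X][X]` is `s`
and the inner one is `t`; `X ≤ Y` in `L(𝒜)` means `Y ⊆ X`. -/
noncomputable def whitneyPoly {F : Type*} [Field F] {d : ℕ} (𝒜 : Set (Set (Fin d → F)))
    [Finite 𝒜] : ℤ[X][X] :=
  letI : Fintype (L 𝒜) := Fintype.ofFinite _
  if Set.univ ∈ 𝒜 then 0
  else ∑ X : L 𝒜, ∑ Y ∈ (Finset.univ : Finset (L 𝒜)).filter (fun Y => Y.1 ⊆ X.1),
    Polynomial.C (Polynomial.C (mobius 𝒜 X Y) * Polynomial.X ^ dim (Y : Set (Fin d → F))) *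
      Polynomial.X ^ (d - dim (X : Set (Fin d → F)))

/-- `c_{ij}(𝒜)` for `j ≤ i ≤ d`: `w(𝒜; s, t) = ∑_{j ≤ i ≤ d} (-1)^j c_{ij}(𝒜) s^{d-i} t^{i-j}`. -/
noncomputable def whitneyCoeff {F : Type*} [Field F] {d : ℕ} (𝒜 : Set (Set (Fin d → F)))
    [Finite 𝒜] (i j : ℕ) : ℤ :=
  (-1) ^ j * ((whitneyPoly 𝒜).coeff (d - i)).coeff (i - j)

/-- The unsigned Whitney number of the first kind `w_k^+(𝒜)` for `k ≤ d`:
`χ(𝒜, t) = ∑_{k ≤ d} (-1)^k w_k^+(𝒜) t^{d-k}`. -/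
noncomputable def whitneyFirst {F : Type*} [Field F] {d : ℕ} (𝒜 : Set (Set (Fin d → F)))
    [Finite 𝒜] (k : ℕ) : ℤ :=
  (-1) ^ k * (charPoly 𝒜).coeff (d - k)

/-- The Whitney number of the second kind `W_k(𝒜)`: the number of members of `L(𝒜)` of
codimension `k`. -/
noncomputable def whitneySecond {F : Type*} [Field F] {d : ℕ} (𝒜 : Set (Set (Fin d → F)))
    (k : ℕ) : ℕ :=
  {X | X ∈ L 𝒜 ∧ d - dim X = k}.ncard

/-- The regions of an arrangement `ℬ` in the ambient space `X`: the connected components of its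
complement. -/
def regions {d : ℕ} (X : Set (Fin d → ℝ)) (ℬ : Set (Set (Fin d → ℝ))) :
    Set (Set (Fin d → ℝ)) :=
  {C | ∃ x ∈ complement X ℬ, C = connectedComponentIn (complement X ℬ) x}

/-- The number `r(𝒜)` of regions of a real arrangement. -/
noncomputable def regionNumber {d : ℕ} (𝒜 : Set (Set (Fin d → ℝ))) : ℕ∞ :=
  (regions Set.univ 𝒜).encard

/-- The `k`-dimensional faces of a real arrangement: the regions of `𝒜/X` for the
`k`-dimensional `X ∈ L(𝒜)`. -/
def faces {d : ℕ} (𝒜 : Set (Set (Fin d → ℝ))) (k : ℕ) : Set (Set (Fin d → ℝ)) :=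
  {C | ∃ X ∈ L 𝒜, dim X = k ∧ C ∈ regions X (restriction 𝒜 X)}

/-- The number `f_k(𝒜)` of `k`-dimensional faces. -/
noncomputable def faceNumber {d : ℕ} (𝒜 : Set (Set (Fin d → ℝ))) (k : ℕ) : ℕ∞ :=
  (faces 𝒜 k).encard

/-- The induced adjoint arrangement in `F^{d+1}`: the hyperplanes with normals `(v, -1)` for the
`0`-dimensional members `{v}` of `L(𝒜)` and `(u, 0)` for the `1`-dimensional members `F u` of
`L(𝒜ᵒ)`, where `𝒜ᵒ = {H_{β_i,0}}` is the linearization of `𝒜 = {H_{β_i,b_i}}`. -/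
def inducedAdjoint {F : Type*} [Field F] {d m : ℕ} (β : Fin m → Fin d → F) (b : Fin m → F) :
    Set (Set (Fin (d + 1) → F)) :=
  {H | ∃ v : Fin d → F, {v} ∈ L (arrangement β b) ∧
      H = hyperplane (Fin.snoc v (-1) : Fin (d + 1) → F) 0} ∪
  {H | ∃ u : Fin d → F, u ≠ 0 ∧ (Submodule.span F {u} : Set (Fin d → F)) ∈ L (arrangement β 0) ∧
      H = hyperplane (Fin.snoc u 0 : Fin (d + 1) → F) 0}

/-- `X` is the stratum `X_x`: the member `X` of `L(𝒜)` with `x ∈ M(𝒜/X)`. -/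
def IsStratum {V : Type*} (𝒜 : Set (Set V)) (x : V) (X : Set V) : Prop :=
  X ∈ L 𝒜 ∧ x ∈ complement X (restriction 𝒜 X)

end HypArr

/-!
Every number in the theorem is a count of no-broken-circuit sets: deletion–restriction shows that
those of `𝒜/X` with intersection `Y` number `|μ(X, Y)|` and, over `ℝ`, that all of them together
number the regions of `𝒜/X`. The flats of `𝒜 + E` are the flats of `𝒜` and the traces `Y ∩ E` of the
flats `Y` transversal to `E`.

Each flat of the essential arrangement `𝒜` contains a `0`-dimensional one, and the smallest flat of
`𝒜ᵒ` through a vector `w` with `α · w ≠ 0` contains a `1`-dimensional flat of `𝒜ᵒ` on which `α` does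
not vanish. Hence an inclusion of strata of the adjoint arrangement says that `E = H_{α,a}` contains
every flat of `𝒜` contained in `E' = H_{α',a'}`, while `E'` meets every flat that `E` cuts properly.
By induction on deletion–restriction, the no-broken-circuit sets of `𝒜 + E` then inject into those
of `𝒜 + E'`, preserving dimensions of intersections; the transversal flats of `E` are also
transversal to `E'`.
-/

namespace HypArr

section Lattice

variable {V : Type*} {𝒜 : Set (Set V)} {E X Y Z : Set V}

theorem univ_mem_L [Nonempty V] (𝒜 : Set (Set V)) : Set.univ ∈ L 𝒜 :=
  ⟨Set.univ_nonempty, ∅, Set.empty_subset _, Set.sInter_empty.symm⟩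

theorem inter_mem_L (hX : X ∈ L 𝒜) {H : Set V} (hH : H ∈ 𝒜) (hne : (X ∩ H).Nonempty) :
    X ∩ H ∈ L 𝒜 := by
  obtain ⟨-, ℬ, hℬ, rfl⟩ := hX
  exact ⟨hne, insert H ℬ, Set.insert_subset hH hℬ, by rw [Set.sInter_insert, Set.inter_comm]⟩

theorem L_mono {ℬ : Set (Set V)} (h : 𝒜 ⊆ ℬ) : L 𝒜 ⊆ L ℬ :=
  fun _ ⟨hne, 𝒞, h𝒞, hX⟩ => ⟨hne, 𝒞, h𝒞.trans h, hX⟩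

theorem subset_of_mem_L (hZ : Z ∈ L 𝒜) (h : ∀ H ∈ 𝒜, Z ⊆ H → Y ⊆ H) : Y ⊆ Z := by
  obtain ⟨-, ℬ, hℬ, rfl⟩ := hZ
  exact Set.subset_sInter fun H hH => h H (hℬ hH) (Set.sInter_subset_of_mem hH)

theorem sInter_localization_mem_L (𝒜 : Set (Set V)) (hX : X.Nonempty) :
    ⋂₀ localization 𝒜 X ∈ L 𝒜 :=
  ⟨hX.mono (Set.subset_sInter fun _ hH => hH.2), _, fun _ hH => hH.1, rfl⟩

theorem mem_L_of_mem_L_insert (hX : X ∈ L (insert E 𝒜)) (hXE : ¬X ⊆ E) : X ∈ L 𝒜 := by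
  obtain ⟨hne, ℬ, hℬ, rfl⟩ := hX
  exact ⟨hne, ℬ, fun H hH => (hℬ hH).resolve_left fun h =>
    hXE (h ▸ Set.sInter_subset_of_mem hH), rfl⟩

/-- The flats of `𝒜` that meet `E` properly and are the smallest flat of `𝒜` containing their
intersection with `E`. Intersecting them with `E` produces the flats of `insert E 𝒜` that are not
flats of `𝒜`, each of them once. -/
def transversalFlats (𝒜 : Set (Set V)) (E : Set V) : Set (Set V) :=
  {Y | Y ∈ L 𝒜 ∧ ¬Y ⊆ E ∧ (Y ∩ E).Nonempty ∧ ∀ H ∈ 𝒜, Y ∩ E ⊆ H → Y ⊆ H}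

theorem subset_of_mem_transversalFlats (hY : Y ∈ transversalFlats 𝒜 E) (hZ : Z ∈ L 𝒜)
    (h : Y ∩ E ⊆ Z) : Y ⊆ Z :=
  subset_of_mem_L hZ fun H hH hZH => hY.2.2.2 H hH (h.trans hZH)

theorem injOn_inter_transversalFlats :
    Set.InjOn (· ∩ E) (transversalFlats 𝒜 E) := by
  intro Y hY Z hZ (h : Y ∩ E = Z ∩ E)
  exact (subset_of_mem_transversalFlats hY hZ.1 (h.trans_subset Set.inter_subset_left)).antisymm
    (subset_of_mem_transversalFlats hZ hY.1 (h.symm.trans_subset Set.inter_subset_left))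

theorem disjoint_L_image_inter_transversalFlats :
    Disjoint (L 𝒜) ((· ∩ E) '' transversalFlats 𝒜 E) := by
  rw [Set.disjoint_left]
  rintro _ hX ⟨Y, hY, rfl⟩
  exact hY.2.1 ((subset_of_mem_transversalFlats hY hX subset_rfl).trans Set.inter_subset_right)

theorem L_insert : L (insert E 𝒜) = L 𝒜 ∪ (· ∩ E) '' transversalFlats 𝒜 E := by
  ext X
  constructor
  · intro hX
    by_cases hXE : X ⊆ E
    · set Y := ⋂₀ localization 𝒜 X
      have hYL : Y ∈ L 𝒜 := sInter_localization_mem_L 𝒜 hX.1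
      have hXY : X ⊆ Y := Set.subset_sInter fun _ hH => hH.2
      have hYE : Y ∩ E = X := by
        refine (subset_of_mem_L hX ?_).antisymm (Set.subset_inter hXY hXE)
        rintro H (rfl | hH) hXH
        · exact Set.inter_subset_right
        · exact Set.inter_subset_left.trans (Set.sInter_subset_of_mem ⟨hH, hXH⟩)
      by_cases hle : Y ⊆ E
      · exact .inl (by rwa [← hYE, Set.inter_eq_left.2 hle])
      · refine .inr ⟨Y, ⟨hYL, hle, hYE ▸ hX.1, fun H hH hH' => ?_⟩, hYE⟩
        exact Set.sInter_subset_of_mem ⟨hH, hYE ▸ hH'⟩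
    · exact .inl (mem_L_of_mem_L_insert hX hXE)
  · rintro (hX | ⟨Y, hY, rfl⟩)
    · exact L_mono (Set.subset_insert _ _) hX
    · exact inter_mem_L (L_mono (Set.subset_insert _ _) hY.1) (Set.mem_insert _ _) hY.2.2.1

theorem IsStratum.subset_of_mem {x : V} (h : IsStratum 𝒜 x X) {H : Set V} (hH : H ∈ 𝒜)
    (hx : x ∈ H) : X ⊆ H := by
  by_contra hX
  exact h.2.2 ⟨H ∩ X, ⟨H, ⟨hH, fun h' => hX h'.2⟩, rfl, ⟨x, hx, h.2.1⟩⟩, hx, h.2.1⟩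

theorem IsStratum.unique {x : V} (hX : IsStratum 𝒜 x X) (hY : IsStratum 𝒜 x Y) : X = Y :=
  (subset_of_mem_L hY.1 fun _ hH hYH => hX.subset_of_mem hH (hYH hY.2.1)).antisymm
    (subset_of_mem_L hX.1 fun _ hH hXH => hY.subset_of_mem hH (hXH hX.2.1))

/-- `E` is at least as special as `E'` relative to the flats of `𝒜`: it contains every flat
contained in `E'`, and `E'` meets every flat that `E` meets without containing it. -/
structure Specializes (𝒜 : Set (Set V)) (E E' : Set V) : Prop where
  subset : ∀ X ∈ L 𝒜, X ⊆ E' → X ⊆ E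
  nonempty : ∀ X ∈ L 𝒜, ¬X ⊆ E → (X ∩ E).Nonempty → (X ∩ E').Nonempty

end Lattice

section Affine

variable {F : Type*} [Field F] {d : ℕ} {X Y : Set (Fin d → F)} {α x y : Fin d → F} {a : F}

theorem mem_hyperplane : x ∈ hyperplane α a ↔ α ⬝ᵥ x = a :=
  Iff.rfl

/-- The subsets of `F^d` underlying an affine subspace, the empty set included. -/
def IsAffine (X : Set (Fin d → F)) : Prop :=
  ∃ s : AffineSubspace F (Fin d → F), (s : Set (Fin d → F)) = X

theorem IsAffine.inter (hX : IsAffine X) (hY : IsAffine Y) : IsAffine (X ∩ Y) := by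
  obtain ⟨⟨s, rfl⟩, t, rfl⟩ := And.intro hX hY
  exact ⟨s ⊓ t, rfl⟩

theorem coe_mk'_ker_dotProduct (α x : Fin d → F) :
    (AffineSubspace.mk' x (dotProductEquiv F (Fin d) α).ker : Set (Fin d → F)) =
      hyperplane α (α ⬝ᵥ x) := by
  ext y
  simp [mem_hyperplane, dotProduct_sub, sub_eq_zero]

theorem isAffine_hyperplane (α : Fin d → F) (a : F) : IsAffine (hyperplane α a) := by
  rcases (hyperplane α a).eq_empty_or_nonempty with h | ⟨x, rfl⟩
  · exact ⟨⊥, h ▸ AffineSubspace.bot_coe F _ _⟩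
  · exact ⟨_, coe_mk'_ker_dotProduct α x⟩

theorem isAffine_univ : IsAffine (Set.univ : Set (Fin d → F)) :=
  ⟨⊤, AffineSubspace.top_coe F _ _⟩

theorem IsAffine.of_mem_L {𝒜 : Set (Set (Fin d → F))} (h𝒜 : ∀ H ∈ 𝒜, IsAffine H)
    (hX : X ∈ L 𝒜) : IsAffine X := by
  obtain ⟨-, ℬ, hℬ, rfl⟩ := hX
  choose! s hs using h𝒜
  refine ⟨⨅ H ∈ ℬ, s H, ?_⟩
  simp only [AffineSubspace.coe_iInf, Set.sInter_eq_biInter]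
  exact Set.iInter₂_congr fun H hH => hs H (hℬ hH)

theorem IsAffine.add_smul_sub_mem (hX : IsAffine X) (hx : x ∈ X) (hy : y ∈ X) (c : F) :
    x + c • (y - x) ∈ X := by
  obtain ⟨s, rfl⟩ := hX
  simpa [add_comm] using s.smul_vsub_vadd_mem c hy hx hx

theorem IsAffine.inter_hyperplane_nonempty (hX : IsAffine X) (hx : x ∈ X) (hy : y ∈ X)
    (h : α ⬝ᵥ x ≠ α ⬝ᵥ y) (a : F) : (X ∩ hyperplane α a).Nonempty := by
  have h0 : α ⬝ᵥ y - α ⬝ᵥ x ≠ 0 := sub_ne_zero.2 h.symm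
  refine ⟨_, hX.add_smul_sub_mem hx hy ((a - α ⬝ᵥ x) / (α ⬝ᵥ y - α ⬝ᵥ x)), ?_⟩
  rw [mem_hyperplane, dotProduct_add, dotProduct_smul, dotProduct_sub, smul_eq_mul,
    div_mul_cancel₀ _ h0, add_sub_cancel]

theorem dim_le (X : Set (Fin d → F)) : dim X ≤ d :=
  (Submodule.finrank_le _).trans_eq (Module.finrank_fin_fun F)

theorem dim_coe (s : AffineSubspace F (Fin d → F)) :
    dim (s : Set (Fin d → F)) = Module.finrank F s.direction := by
  rw [dim, s.direction_eq_vectorSpan]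

theorem dim_univ : dim (Set.univ : Set (Fin d → F)) = d := by
  rw [← AffineSubspace.top_coe F, dim_coe, AffineSubspace.direction_top, finrank_top,
    Module.finrank_fin_fun]

theorem IsAffine.eq_of_subset_of_dim_eq (hX : IsAffine X) (hY : IsAffine Y) (hne : X.Nonempty)
    (h : X ⊆ Y) (hd : dim X = dim Y) : X = Y := by
  obtain ⟨⟨s, rfl⟩, t, rfl⟩ := And.intro hX hY
  rw [dim_coe, dim_coe] at hd
  exact congrArg _ (AffineSubspace.eq_of_direction_eq_of_nonempty_of_le
    (Submodule.eq_of_le_of_finrank_eq (AffineSubspace.direction_le h) hd) hne h)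

theorem finrank_inf_ker_add_one {V : Type*} [AddCommGroup V] [Module F V] {W : Submodule F V}
    [FiniteDimensional F W] {φ : Module.Dual F V} (h : ¬W ≤ φ.ker) :
    Module.finrank F ↥(W ⊓ φ.ker) + 1 = Module.finrank F W := by
  have hφ : φ.domRestrict W ≠ 0 := fun h0 => h fun w hw => LinearMap.congr_fun h0 ⟨w, hw⟩
  rw [← Submodule.map_comap_subtype, Submodule.finrank_map_subtype_eq, ← LinearMap.ker_domRestrict]
  exact Module.Dual.finrank_ker_add_one_of_ne_zero hφ

theorem IsAffine.dim_inter_hyperplane_add_one (hX : IsAffine X)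
    (hne : (X ∩ hyperplane α a).Nonempty) (hsub : ¬X ⊆ hyperplane α a) :
    dim (X ∩ hyperplane α a) + 1 = dim X := by
  obtain ⟨s, rfl⟩ := hX
  obtain ⟨x, hxs, rfl⟩ := hne
  have hker : ¬s.direction ≤ (dotProductEquiv F (Fin d) α).ker := by
    obtain ⟨y, hys, hy⟩ := Set.not_subset.1 hsub
    refine fun h => hy (sub_eq_zero.1 ?_)
    rw [← dotProduct_sub]
    exact h (s.vsub_mem_direction hys hxs)
  have hcoe : ↑s ∩ hyperplane α (α ⬝ᵥ x) =
      ↑(s ⊓ AffineSubspace.mk' x (dotProductEquiv F (Fin d) α).ker) := by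
    rw [← coe_mk'_ker_dotProduct]
    rfl
  rw [hcoe, dim_coe, dim_coe,
    AffineSubspace.direction_inf_of_mem hxs (AffineSubspace.self_mem_mk' x _),
    AffineSubspace.direction_mk', finrank_inf_ker_add_one hker]

theorem IsAffine.inter_hyperplane_eq_of_subset {α' : Fin d → F} {a' : F} (hX : IsAffine X)
    (hne : (X ∩ hyperplane α a).Nonempty) (hα : ¬X ⊆ hyperplane α a)
    (hα' : ¬X ⊆ hyperplane α' a') (h : X ∩ hyperplane α a ⊆ hyperplane α' a') :
    X ∩ hyperplane α a = X ∩ hyperplane α' a' := by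
  have hsub : X ∩ hyperplane α a ⊆ X ∩ hyperplane α' a' :=
    Set.subset_inter Set.inter_subset_left h
  refine (hX.inter (isAffine_hyperplane _ _)).eq_of_subset_of_dim_eq
    (hX.inter (isAffine_hyperplane _ _)) hne hsub (Nat.succ_injective ?_)
  exact (hX.dim_inter_hyperplane_add_one hne hα).trans
    (hX.dim_inter_hyperplane_add_one (hne.mono hsub) hα').symm

end Affine

section NoBrokenCircuit

variable {F : Type*} [Field F] {d : ℕ}

/-- The equation `α · x = a` on `F^d`, encoded as the pair `(α, a)`. Arrangements are given by lists
of equations because counting no-broken-circuit sets needs an ordering of the hyperplanes. -/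
abbrev Equation (F : Type*) (d : ℕ) : Type _ :=
  (Fin d → F) × F

/-- The hyperplane, or degenerate solution set, of an equation. -/
abbrev solutions (p : Equation F d) : Set (Fin d → F) :=
  hyperplane p.1 p.2

/-- The arrangement of the solution sets of a list of equations. -/
def hyperplanes (𝒜 : List (Equation F d)) : Set (Set (Fin d → F)) :=
  {H | ∃ p ∈ 𝒜, solutions p = H}

variable {𝒜 : List (Equation F d)} {p : Equation F d} {X Y : Set (Fin d → F)}

theorem solutions_mem_hyperplanes (hp : p ∈ 𝒜) : solutions p ∈ hyperplanes 𝒜 :=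
  ⟨p, hp, rfl⟩

theorem hyperplanes_cons (p : Equation F d) (𝒜 : List (Equation F d)) :
    hyperplanes (p :: 𝒜) = insert (solutions p) (hyperplanes 𝒜) := by
  ext H
  simp [hyperplanes, eq_comm]

instance (𝒜 : List (Equation F d)) : Finite (hyperplanes 𝒜) :=
  (𝒜.finite_toSet.image solutions).to_subtype

theorem IsAffine.of_mem_L_hyperplanes (hX : X ∈ L (hyperplanes 𝒜)) : IsAffine X := by
  refine .of_mem_L ?_ hX
  rintro _ ⟨p, -, rfl⟩
  exact isAffine_hyperplane p.1 p.2

open Classical in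
/-- The flats `X ∩ ⋂ S`, where `S` runs through the no-broken-circuit sets of the arrangement `𝒜`
restricted to `X`, each flat counted as often as it arises; broken circuits are taken with respect
to the order of the list, its head being the largest element. The recursion is deletion and
restriction of the head. When `𝒜` consists of the equations that cut `X` properly, the multiplicity
of a flat `Y` is `|μ(X, Y)|`. -/
noncomputable def nbcFlats : List (Equation F d) → Set (Fin d → F) → Multiset (Set (Fin d → F))
  | [], X => if X.Nonempty then {X} else 0
  | p :: 𝒜, X => if X ⊆ solutions p then 0 else nbcFlats 𝒜 X + nbcFlats 𝒜 (X ∩ solutions p)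

theorem nbcFlats_nil (hX : X.Nonempty) : nbcFlats [] X = {X} :=
  if_pos hX

theorem nbcFlats_cons_of_subset (h : X ⊆ solutions p) : nbcFlats (p :: 𝒜) X = 0 :=
  if_pos h

theorem nbcFlats_cons (h : ¬X ⊆ solutions p) :
    nbcFlats (p :: 𝒜) X = nbcFlats 𝒜 X + nbcFlats 𝒜 (X ∩ solutions p) :=
  if_neg h

theorem nbcFlats_empty (𝒜 : List (Equation F d)) : nbcFlats 𝒜 ∅ = 0 := by
  cases 𝒜 with
  | nil => exact if_neg Set.not_nonempty_empty
  | cons p 𝒜 => exact nbcFlats_cons_of_subset (Set.empty_subset _)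

theorem nbcFlats_eq_zero (hp : p ∈ 𝒜) (h : X ⊆ solutions p) : nbcFlats 𝒜 X = 0 := by
  induction 𝒜 generalizing X with
  | nil => simp at hp
  | cons q 𝒜 ih =>
    by_cases hq : X ⊆ solutions q
    · exact nbcFlats_cons_of_subset hq
    · obtain rfl | hp := List.mem_cons.1 hp
      · exact absurd h hq
      · rw [nbcFlats_cons hq, ih hp h, ih hp (Set.inter_subset_left.trans h), add_zero]

theorem subset_of_mem_nbcFlats (hY : Y ∈ nbcFlats 𝒜 X) : Y ⊆ X := by
  induction 𝒜 generalizing X with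
  | nil => by_cases hX : X.Nonempty <;> simp_all [nbcFlats]
  | cons p 𝒜 ih =>
    by_cases hp : X ⊆ solutions p
    · simp [nbcFlats_cons_of_subset hp] at hY
    · rw [nbcFlats_cons hp, Multiset.mem_add] at hY
      exact hY.elim ih fun h => (ih h).trans Set.inter_subset_left

theorem mem_L_of_mem_nbcFlats {ℬ : Set (Set (Fin d → F))} (h𝒜 : hyperplanes 𝒜 ⊆ ℬ) (hX : X ∈ L ℬ)
    (hY : Y ∈ nbcFlats 𝒜 X) : Y ∈ L ℬ := by
  induction 𝒜 generalizing X with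
  | nil => by_cases hX : X.Nonempty <;> simp_all [nbcFlats]
  | cons p 𝒜 ih =>
    rw [hyperplanes_cons, Set.insert_subset_iff] at h𝒜
    by_cases hp : X ⊆ solutions p
    · simp [nbcFlats_cons_of_subset hp] at hY
    rw [nbcFlats_cons hp, Multiset.mem_add] at hY
    refine hY.elim (ih h𝒜.2 hX) fun h => ?_
    obtain h0 | hne := (X ∩ solutions p).eq_empty_or_nonempty
    · simp [h0, nbcFlats_empty] at h
    · exact ih h𝒜.2 (inter_mem_L hX h𝒜.1 hne) h

open Classical in
theorem sum_neg_one_pow_dim_nbcFlats (hX : IsAffine X) (hY : Y.Nonempty) (hYX : Y ⊆ X) :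
    (((nbcFlats 𝒜 X).filter (Y ⊆ ·)).map fun Z => (-1 : ℤ) ^ dim Z).sum =
      if ∃ p ∈ 𝒜, Y ⊆ solutions p then 0 else (-1) ^ dim X := by
  induction 𝒜 generalizing X with
  | nil => simp [nbcFlats_nil (hY.mono hYX), Multiset.filter_singleton, hYX]
  | cons p 𝒜 ih =>
    by_cases hp : X ⊆ solutions p
    · simp [nbcFlats_cons_of_subset hp, hYX.trans hp]
    rw [nbcFlats_cons hp, Multiset.filter_add, Multiset.map_add, Multiset.sum_add, ih hX hYX]
    by_cases hYp : Y ⊆ solutions p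
    · have hY' : Y ⊆ X ∩ solutions p := Set.subset_inter hYX hYp
      rw [ih (hX.inter (isAffine_hyperplane _ _)) hY',
        ← hX.dim_inter_hyperplane_add_one (hY.mono hY') hp, pow_succ]
      by_cases h : ∃ q ∈ 𝒜, Y ⊆ solutions q <;> simp [h, hYp]
    · have h0 : (nbcFlats 𝒜 (X ∩ solutions p)).filter (Y ⊆ ·) = 0 :=
        Multiset.filter_eq_nil.2 fun Z hZ hYZ =>
          hYp (hYZ.trans ((subset_of_mem_nbcFlats hZ).trans Set.inter_subset_right))
      simp [h0, hYp]

open Classical in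
/-- The equations of `𝒜` that do not hold identically on `X`; they define `𝒜/X`. -/
noncomputable def cutting (𝒜 : List (Equation F d)) (X : Set (Fin d → F)) :
    List (Equation F d) :=
  𝒜.filter fun p => ¬X ⊆ solutions p

theorem mem_cutting : p ∈ cutting 𝒜 X ↔ p ∈ 𝒜 ∧ ¬X ⊆ solutions p := by
  simp [cutting]

theorem cutting_subset : cutting 𝒜 X ⊆ 𝒜 :=
  List.filter_subset_self _

theorem hyperplanes_cutting_subset : hyperplanes (cutting 𝒜 X) ⊆ hyperplanes 𝒜 := by
  rintro _ ⟨p, hp, rfl⟩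
  exact solutions_mem_hyperplanes (cutting_subset hp)

theorem exists_mem_cutting_subset_iff (hY : Y ∈ L (hyperplanes 𝒜))
    (hYX : Y ⊆ X) :
    (∃ p ∈ cutting 𝒜 X, Y ⊆ solutions p) ↔ X ≠ Y := by
  constructor
  · rintro ⟨p, hp, hYp⟩ rfl
    exact (mem_cutting.1 hp).2 hYp
  · intro hne
    by_contra! h
    refine hne (Set.Subset.antisymm (subset_of_mem_L hY ?_) hYX)
    rintro _ ⟨p, hp, rfl⟩ hYp
    by_contra hXp
    exact h p (mem_cutting.2 ⟨hp, hXp⟩) hYp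

end NoBrokenCircuit

section Mobius

theorem sum_count_mul {α : Type*} [DecidableEq α] {s : Set α} [Fintype s] {N : Multiset α}
    (hN : ∀ x ∈ N, x ∈ s) (g : α → ℤ) :
    ∑ x : s, (N.count x.1 : ℤ) * g x = (N.map g).sum := by
  rw [Finset.sum_set_coe (f := fun x => (N.count x : ℤ) * g x), Finset.sum_multiset_map_count]
  simp only [nsmul_eq_mul]
  refine (Finset.sum_subset (fun x hx => ?_) fun x _ hx => ?_).symm
  · exact Set.mem_toFinset.2 (hN x (Multiset.mem_toFinset.1 hx))
  · rw [Multiset.count_eq_zero.2 (mt Multiset.mem_toFinset.2 hx), Nat.cast_zero, zero_mul]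

open Classical in
theorem mobius_eq_of_sum_eq {V : Type*} {𝒜 : Set (Set V)} [Finite 𝒜] [Fintype (L 𝒜)]
    {f : L 𝒜 → L 𝒜 → ℤ}
    (h : ∀ X Z : L 𝒜, Z.1 ⊆ X.1 →
      ∑ Y : L 𝒜 with Z.1 ⊆ Y.1 ∧ Y.1 ⊆ X.1, f X Y = if X = Z then 1 else 0)
    {X Y : L 𝒜} (hYX : Y.1 ⊆ X.1) : mobius 𝒜 X Y = f X Y := by
  let : Fintype (L 𝒜)ᵒᵈ := Fintype.ofFinite _
  let : LocallyFiniteOrder (L 𝒜)ᵒᵈ := Fintype.toLocallyFiniteOrder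
  let ν : IncidenceAlgebra ℤ (L 𝒜)ᵒᵈ :=
    ⟨fun a b => if a ≤ b then f a.ofDual b.ofDual else 0, fun a b hab => if_neg hab⟩
  have hν : ν * IncidenceAlgebra.zeta ℤ = 1 := by
    ext a b hab
    rw [IncidenceAlgebra.mul_apply, IncidenceAlgebra.one_apply]
    refine Eq.trans ?_ (h a.ofDual b.ofDual hab)
    refine Finset.sum_equiv OrderDual.ofDual (fun x => ?_) fun x hx => ?_
    · rw [Finset.mem_Icc, Finset.mem_filter_univ, and_comm]
      rfl
    · rw [Finset.mem_Icc] at hx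
      rw [IncidenceAlgebra.zeta_of_le hx.2, mul_one]
      exact if_pos hx.1
  have hmu : ν = IncidenceAlgebra.mu ℤ :=
    left_inv_eq_right_inv hν IncidenceAlgebra.zeta_mul_mu
  have hXY : OrderDual.toDual X ≤ OrderDual.toDual Y := hYX
  exact (congrArg (fun g => g (.toDual X) (.toDual Y)) hmu).symm.trans (if_pos hXY)

variable {F : Type*} [Field F] {d : ℕ} {𝒜 : List (Equation F d)}

open Classical in
theorem mobius_eq_count (X Y : L (hyperplanes 𝒜)) (hYX : Y.1 ⊆ X.1) :
    mobius (hyperplanes 𝒜) X Y =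
      (-1) ^ dim X.1 * ((nbcFlats (cutting 𝒜 X) X).count Y.1 * (-1) ^ dim Y.1) := by
  let : Fintype (L (hyperplanes 𝒜)) := Fintype.ofFinite _
  refine mobius_eq_of_sum_eq (f := fun X Y =>
    (-1) ^ dim X.1 * ((nbcFlats (cutting 𝒜 X) X).count Y.1 * (-1) ^ dim Y.1)) ?_ hYX
  intro X Z hZX
  set N := (nbcFlats (cutting 𝒜 X) X).filter (Z.1 ⊆ ·) with hN
  have hNL : ∀ Y ∈ N, Y ∈ L (hyperplanes 𝒜) := fun Y hY =>
    mem_L_of_mem_nbcFlats hyperplanes_cutting_subset X.2 (Multiset.mem_of_mem_filter hY)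
  have hcount : ∀ Y : L (hyperplanes 𝒜), N.count Y.1 =
      if Z.1 ⊆ Y.1 ∧ Y.1 ⊆ X.1 then (nbcFlats (cutting 𝒜 X) X).count Y.1 else 0 := by
    intro Y
    rw [hN, Multiset.count_filter, ite_and]
    refine if_congr Iff.rfl ?_ rfl
    split_ifs with hY
    · rfl
    · exact Multiset.count_eq_zero.2 fun h => hY (subset_of_mem_nbcFlats h)
  calc _ = (-1) ^ dim X.1 * ∑ Y : L (hyperplanes 𝒜), (N.count Y.1 : ℤ) * (-1) ^ dim Y.1 := by
        simp only [hcount, Finset.mul_sum, Finset.sum_filter, Nat.cast_ite, ite_mul, mul_ite,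
          Nat.cast_zero, zero_mul, mul_zero]
    _ = (-1) ^ dim X.1 * if ∃ p ∈ cutting 𝒜 X, Z.1 ⊆ solutions p then 0 else (-1) ^ dim X.1 := by
        rw [sum_count_mul hNL fun Y => (-1) ^ dim Y, hN,
          sum_neg_one_pow_dim_nbcFlats (.of_mem_L_hyperplanes X.2) Z.2.1 hZX]
    _ = if X = Z then 1 else 0 := by
        simp only [exists_mem_cutting_subset_iff Z.2 hZX, ne_eq, ← Subtype.ext_iff, ite_not,
          mul_ite, mul_zero, ← mul_pow, neg_mul_neg, mul_one, one_pow]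

end Mobius

section FlatsOfDim

variable {F : Type*} [Field F] {d : ℕ}

/-- The `k`-dimensional flats of `𝒜`. -/
noncomputable def flatsOfDim (𝒜 : Set (Set (Fin d → F))) [Finite 𝒜] (k : ℕ) :
    Finset (Set (Fin d → F)) :=
  (Set.toFinite (L 𝒜 ∩ {X | dim X = k})).toFinset

theorem mem_flatsOfDim {𝒜 : Set (Set (Fin d → F))} [Finite 𝒜] {k : ℕ} {X : Set (Fin d → F)} :
    X ∈ flatsOfDim 𝒜 k ↔ X ∈ L 𝒜 ∧ dim X = k :=
  Set.Finite.mem_toFinset _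

theorem sum_ite_dim_eq {M : Type*} [AddCommMonoid M] {𝒜 : Set (Set (Fin d → F))} [Finite 𝒜]
    [Fintype (L 𝒜)] (k : ℕ) (f : Set (Fin d → F) → M) :
    (∑ X : L 𝒜, if dim X.1 = k then f X else 0) = ∑ X ∈ flatsOfDim 𝒜 k, f X := by
  rw [Finset.sum_set_coe (f := fun X => if dim X = k then f X else 0), ← Finset.sum_filter]
  exact Finset.sum_congr (by ext; simp [mem_flatsOfDim]) fun _ _ => rfl

theorem whitneySecond_eq_card {𝒜 : Set (Set (Fin d → F))} [Finite 𝒜] {k : ℕ} (hk : k ≤ d) :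
    whitneySecond 𝒜 k = (flatsOfDim 𝒜 (d - k)).card := by
  rw [whitneySecond, ← Set.ncard_coe_finset]
  congr 1
  ext X
  have := dim_le X
  rw [SetLike.mem_coe, mem_flatsOfDim]
  exact and_congr_right fun _ => by omega

variable {𝒜 : List (Equation F d)}

/-- The dimensions of the flats cut out by the no-broken-circuit sets of `𝒜/X`. The multiplicity of
`k` is the `(dim X - k)`-th unsigned Whitney number of the first kind of `𝒜/X`. -/
noncomputable def whitneyDims (𝒜 : List (Equation F d)) (X : Set (Fin d → F)) : Multiset ℕ :=
  (nbcFlats (cutting 𝒜 X) X).map dim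

open Classical in
theorem sum_mobius_dim_eq [Fintype (L (hyperplanes 𝒜))] (X : L (hyperplanes 𝒜)) (k : ℕ) :
    (∑ Y : L (hyperplanes 𝒜) with Y.1 ⊆ X.1,
      if dim Y.1 = k then mobius (hyperplanes 𝒜) X Y else 0) =
      (-1) ^ (dim X.1 + k) * ((whitneyDims 𝒜 X).count k : ℤ) := by
  set N := nbcFlats (cutting 𝒜 X) X with hN
  have hNL : ∀ Y ∈ N, Y ∈ L (hyperplanes 𝒜) := fun _ =>
    mem_L_of_mem_nbcFlats hyperplanes_cutting_subset X.2
  have hsum : (N.map fun Y => if dim Y = k then (-1 : ℤ) ^ k else 0).sum =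
      (-1) ^ k * ((N.map dim).count k : ℤ) := by
    have := (N.map dim).sum_map_eq_nsmul_single (f := fun m => if m = k then (-1 : ℤ) ^ k else 0) k
      fun m hm _ => if_neg hm
    rwa [Multiset.map_map, if_pos rfl, nsmul_eq_mul, mul_comm] at this
  calc _ = (-1) ^ dim X.1 *
        ∑ Y : L (hyperplanes 𝒜), (N.count Y.1 : ℤ) * if dim Y.1 = k then (-1) ^ k else 0 := by
        rw [Finset.mul_sum, Finset.sum_filter]
        refine Finset.sum_congr rfl fun Y _ => ?_
        by_cases hYX : Y.1 ⊆ X.1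
        · rw [if_pos hYX, mobius_eq_count X Y hYX, ← hN]
          split_ifs with hk
          · rw [hk]
          · rw [mul_zero, mul_zero]
        · rw [if_neg hYX, Multiset.count_eq_zero.2 fun h => hYX (subset_of_mem_nbcFlats h)]
          simp
    _ = _ := by
        rw [sum_count_mul hNL fun Y => if dim Y = k then (-1) ^ k else 0, hsum, ← mul_assoc,
          ← pow_add, whitneyDims]

open Classical in
theorem whitneyFirst_eq_count {k : ℕ} (hk : k ≤ d) :
    whitneyFirst (hyperplanes 𝒜) k = ((nbcFlats 𝒜 Set.univ).map dim).count (d - k) := by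
  rw [whitneyFirst, charPoly]
  split_ifs with hu
  · obtain ⟨p, hp, hpu⟩ := hu
    simp [nbcFlats_eq_zero hp hpu.ge]
  · have hcut : cutting 𝒜 Set.univ = 𝒜 := by
      simpa [cutting, List.filter_eq_self, Set.univ_subset_iff, hyperplanes] using hu
    let := Fintype.ofFinite (L (hyperplanes 𝒜))
    have h := sum_mobius_dim_eq ⟨_, univ_mem_L (hyperplanes 𝒜)⟩ (d - k)
    rw [Finset.filter_true_of_mem fun _ _ => Set.subset_univ _, dim_univ, whitneyDims, hcut] at h
    simp only [Polynomial.finsetSum_coeff, Polynomial.coeff_C_mul_X_pow]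
    simp only [eq_comm (a := d - k)]
    rw [h, ← mul_assoc, ← pow_add, Even.neg_one_pow (by grind), one_mul]

open Classical in
theorem whitneyCoeff_eq_sum_count (hu : Set.univ ∉ hyperplanes 𝒜) {i j : ℕ} (hj : j ≤ i)
    (hi : i ≤ d) :
    whitneyCoeff (hyperplanes 𝒜) i j =
      ∑ X ∈ flatsOfDim (hyperplanes 𝒜) i, ((whitneyDims 𝒜 X).count (i - j) : ℤ) := by
  let := Fintype.ofFinite (L (hyperplanes 𝒜))
  rw [whitneyCoeff, whitneyPoly, if_neg hu, ← sum_ite_dim_eq, Polynomial.finsetSum_coeff,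
    Polynomial.finsetSum_coeff, Finset.mul_sum]
  refine Finset.sum_congr rfl fun X _ => ?_
  have hdim : d - i = d - dim X.1 ↔ dim X.1 = i := by have := dim_le X.1; omega
  simp only [Polynomial.finsetSum_coeff, Polynomial.coeff_C_mul_X_pow, hdim]
  split_ifs with hX
  · simp only [Polynomial.coeff_C_mul_X_pow, eq_comm (a := i - j)]
    rw [sum_mobius_dim_eq X (i - j), ← mul_assoc, ← pow_add, Even.neg_one_pow (by grind), one_mul]
  · simp

end FlatsOfDim

section Comparison

variable {F : Type*} [Field F] {d : ℕ} {𝒜 ℬ : List (Equation F d)} {p p' q : Equation F d}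
  {X Y : Set (Fin d → F)}

open Classical in
theorem sum_flatsOfDim_cons (p : Equation F d) (𝒜 : List (Equation F d)) (k : ℕ)
    (f : Set (Fin d → F) → ℕ) :
    ∑ X ∈ flatsOfDim (hyperplanes (p :: 𝒜)) k, f X =
      ∑ X ∈ flatsOfDim (hyperplanes 𝒜) k, f X +
        ∑ Y ∈ flatsOfDim (hyperplanes 𝒜) (k + 1) with
          Y ∈ transversalFlats (hyperplanes 𝒜) (solutions p), f (Y ∩ solutions p) := by
  set 𝒯 := {Y ∈ flatsOfDim (hyperplanes 𝒜) (k + 1) |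
    Y ∈ transversalFlats (hyperplanes 𝒜) (solutions p)} with h𝒯
  have hdim : ∀ Y ∈ transversalFlats (hyperplanes 𝒜) (solutions p),
      dim (Y ∩ solutions p) + 1 = dim Y := fun Y hY =>
    (IsAffine.of_mem_L_hyperplanes hY.1).dim_inter_hyperplane_add_one hY.2.2.1 hY.2.1
  have hflats : flatsOfDim (hyperplanes (p :: 𝒜)) k =
      flatsOfDim (hyperplanes 𝒜) k ∪ 𝒯.image (· ∩ solutions p) := by
    ext X
    rw [Finset.mem_union, Finset.mem_image, mem_flatsOfDim, mem_flatsOfDim, hyperplanes_cons,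
      L_insert, Set.mem_union, or_and_right]
    refine or_congr Iff.rfl ⟨?_, ?_⟩
    · rintro ⟨⟨Y, hY, rfl⟩, rfl⟩
      exact ⟨Y, Finset.mem_filter.2 ⟨mem_flatsOfDim.2 ⟨hY.1, (hdim Y hY).symm⟩, hY⟩, rfl⟩
    · rintro ⟨Y, hY, rfl⟩
      rw [h𝒯, Finset.mem_filter, mem_flatsOfDim] at hY
      exact ⟨⟨Y, hY.2, rfl⟩, Nat.succ_injective ((hdim Y hY.2).trans hY.1.2)⟩
  rw [hflats, Finset.sum_union, Finset.sum_image]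
  · exact injOn_inter_transversalFlats.mono fun Y hY => (Finset.mem_filter.1 hY).2
  · refine Finset.disjoint_left.2 fun X hX hX' => ?_
    obtain ⟨Y, hY, rfl⟩ := Finset.mem_image.1 hX'
    exact Set.disjoint_left.1 disjoint_L_image_inter_transversalFlats (mem_flatsOfDim.1 hX).1
      ⟨Y, (Finset.mem_filter.1 hY).2, rfl⟩

theorem cutting_cons_inter (hY : Y ∈ transversalFlats (hyperplanes 𝒜) (solutions p)) :
    cutting (p :: 𝒜) (Y ∩ solutions p) = cutting 𝒜 Y := by
  rw [cutting, List.filter_cons_of_neg (by simp)]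
  refine List.filter_congr fun q hq => decide_eq_decide.2 (not_congr ⟨?_, ?_⟩)
  · exact hY.2.2.2 _ (solutions_mem_hyperplanes hq)
  · exact Set.inter_subset_left.trans

namespace Specializes

theorem inter_subset_of_inter_subset
    (h : Specializes (hyperplanes 𝒜) (solutions p) (solutions p')) (hX : X ∈ L (hyperplanes 𝒜))
    (hXp : ¬X ⊆ solutions p) (hq : q ∈ 𝒜) (hsub : X ∩ solutions p' ⊆ solutions q) :
    X ∩ solutions p ⊆ solutions q := by
  by_contra hcon
  obtain ⟨x, hx, hxq⟩ := Set.not_subset.1 hcon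
  have hXq : ¬X ⊆ solutions q := fun h => hxq (h hx.1)
  have heq : X ∩ solutions p' = X ∩ solutions q :=
    (IsAffine.of_mem_L_hyperplanes hX).inter_hyperplane_eq_of_subset (h.nonempty X hX hXp ⟨x, hx⟩)
      (mt (h.subset X hX) hXp) hXq hsub
  have hqL : X ∩ solutions q ∈ L (hyperplanes 𝒜) :=
    inter_mem_L hX (solutions_mem_hyperplanes hq) (heq ▸ h.nonempty X hX hXp ⟨x, hx⟩)
  have hqp : X ∩ solutions q ⊆ solutions p := h.subset _ hqL (heq ▸ Set.inter_subset_right)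
  have hqp' : X ∩ solutions q = X ∩ solutions p :=
    (IsAffine.of_mem_L_hyperplanes hX).inter_hyperplane_eq_of_subset hqL.1 hXq hXp hqp
  exact hxq (hqp'.ge hx).2

theorem transversalFlats_subset
    (h : Specializes (hyperplanes 𝒜) (solutions p) (solutions p')) :
    transversalFlats (hyperplanes 𝒜) (solutions p) ⊆
      transversalFlats (hyperplanes 𝒜) (solutions p') := by
  rintro Y ⟨hY, hYp, hne, hmin⟩
  refine ⟨hY, mt (h.subset Y hY) hYp, h.nonempty Y hY hYp hne, ?_⟩
  rintro _ ⟨q, hq, rfl⟩ hsub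
  exact hmin _ (solutions_mem_hyperplanes hq) (h.inter_subset_of_inter_subset hY hYp hq hsub)

theorem map_dim_nbcFlats_inter_le
    (h : Specializes (hyperplanes 𝒜) (solutions p) (solutions p')) (hℬ : ℬ ⊆ 𝒜)
    (hX : X ∈ L (hyperplanes 𝒜)) (hXp : ¬X ⊆ solutions p) :
    (nbcFlats ℬ (X ∩ solutions p)).map dim ≤ (nbcFlats ℬ (X ∩ solutions p')).map dim := by
  obtain h0 | hne := (X ∩ solutions p).eq_empty_or_nonempty
  · simp [h0, nbcFlats_empty]
  induction ℬ generalizing X with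
  | nil =>
    have hdim : dim (X ∩ solutions p) = dim (X ∩ solutions p') := by
      have hXaff := IsAffine.of_mem_L_hyperplanes hX
      refine Nat.succ_injective ((hXaff.dim_inter_hyperplane_add_one hne hXp).trans ?_)
      exact (hXaff.dim_inter_hyperplane_add_one (h.nonempty X hX hXp hne)
        (mt (h.subset X hX) hXp)).symm
    simp [nbcFlats_nil hne, nbcFlats_nil (h.nonempty X hX hXp hne), hdim]
  | cons q ℬ ih =>
    rw [List.cons_subset] at hℬ
    by_cases hq : X ∩ solutions p ⊆ solutions q
    · simp [nbcFlats_cons_of_subset hq]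
    rw [nbcFlats_cons hq,
      nbcFlats_cons (mt (h.inter_subset_of_inter_subset hX hXp hℬ.1) hq), Multiset.map_add,
      Multiset.map_add, Set.inter_right_comm X (solutions p),
      Set.inter_right_comm X (solutions p')]
    refine add_le_add (ih hℬ.2 hX hXp hne) ?_
    obtain h0 | hne' := (X ∩ solutions q ∩ solutions p).eq_empty_or_nonempty
    · simp [h0, nbcFlats_empty]
    have hXq : X ∩ solutions q ∈ L (hyperplanes 𝒜) :=
      inter_mem_L hX (solutions_mem_hyperplanes hℬ.1) (hne'.mono Set.inter_subset_left)
    refine ih hℬ.2 hXq (fun hsub => hq ?_) hne'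
    have heq : X ∩ solutions q = X ∩ solutions p :=
      (IsAffine.of_mem_L_hyperplanes hX).inter_hyperplane_eq_of_subset hXq.1
        (fun hXq => hq (Set.inter_subset_left.trans hXq)) hXp hsub
    exact heq.ge.trans Set.inter_subset_right

theorem map_dim_nbcFlats_cons_le
    (h : Specializes (hyperplanes 𝒜) (solutions p) (solutions p')) (hℬ : ℬ ⊆ 𝒜)
    (hX : X ∈ L (hyperplanes 𝒜)) :
    (nbcFlats (p :: ℬ) X).map dim ≤ (nbcFlats (p' :: ℬ) X).map dim := by
  by_cases hXp : X ⊆ solutions p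
  · simp [nbcFlats_cons_of_subset hXp]
  rw [nbcFlats_cons hXp, nbcFlats_cons (mt (h.subset X hX) hXp), Multiset.map_add,
    Multiset.map_add]
  exact add_le_add_right (h.map_dim_nbcFlats_inter_le hℬ hX hXp) _

theorem whitneyDims_cons_le
    (h : Specializes (hyperplanes 𝒜) (solutions p) (solutions p')) (hX : X ∈ L (hyperplanes 𝒜)) :
    whitneyDims (p :: 𝒜) X ≤ whitneyDims (p' :: 𝒜) X := by
  by_cases hXp : X ⊆ solutions p
  · by_cases hXp' : X ⊆ solutions p'
    · simp [whitneyDims, cutting, hXp, hXp']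
    · rw [whitneyDims, whitneyDims, cutting, cutting, List.filter_cons_of_neg (by simpa using hXp),
        List.filter_cons_of_pos (by simpa using hXp'), nbcFlats_cons hXp']
      exact Multiset.map_le_map (Multiset.le_add_right _ _)
  · rw [whitneyDims, whitneyDims, cutting, cutting, List.filter_cons_of_pos (by simpa using hXp),
      List.filter_cons_of_pos (by simpa using mt (h.subset X hX) hXp)]
    exact h.map_dim_nbcFlats_cons_le cutting_subset hX

theorem whitneyDims_cons_inter_le
    (h : Specializes (hyperplanes 𝒜) (solutions p) (solutions p'))
    (hY : Y ∈ transversalFlats (hyperplanes 𝒜) (solutions p)) :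
    whitneyDims (p :: 𝒜) (Y ∩ solutions p) ≤ whitneyDims (p' :: 𝒜) (Y ∩ solutions p') := by
  rw [whitneyDims, whitneyDims, cutting_cons_inter hY,
    cutting_cons_inter (h.transversalFlats_subset hY)]
  exact h.map_dim_nbcFlats_inter_le cutting_subset hY.1 hY.2.1

theorem sum_flatsOfDim_le
    (h : Specializes (hyperplanes 𝒜) (solutions p) (solutions p')) (k : ℕ)
    {f f' : Set (Fin d → F) → ℕ} (hold : ∀ X ∈ L (hyperplanes 𝒜), f X ≤ f' X)
    (hnew : ∀ Y ∈ transversalFlats (hyperplanes 𝒜) (solutions p),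
      f (Y ∩ solutions p) ≤ f' (Y ∩ solutions p')) :
    ∑ X ∈ flatsOfDim (hyperplanes (p :: 𝒜)) k, f X ≤
      ∑ X ∈ flatsOfDim (hyperplanes (p' :: 𝒜)) k, f' X := by
  classical
  rw [sum_flatsOfDim_cons, sum_flatsOfDim_cons]
  refine add_le_add (Finset.sum_le_sum fun X hX => hold X (mem_flatsOfDim.1 hX).1) ?_
  refine (Finset.sum_le_sum fun Y hY => hnew Y (Finset.mem_filter.1 hY).2).trans ?_
  exact Finset.sum_le_sum_of_subset
    (Finset.monotone_filter_right _ fun Y _ hY => h.transversalFlats_subset hY)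

theorem univ_mem_hyperplanes_cons
    (h : Specializes (hyperplanes 𝒜) (solutions p) (solutions p'))
    (hu : Set.univ ∈ hyperplanes (p' :: 𝒜)) : Set.univ ∈ hyperplanes (p :: 𝒜) := by
  rw [hyperplanes_cons] at hu ⊢
  exact hu.imp_left fun hp' =>
    (Set.univ_subset_iff.1 (h.subset _ (univ_mem_L _) hp'.subset)).symm

theorem whitneyCoeff_le
    (h : Specializes (hyperplanes 𝒜) (solutions p) (solutions p')) {i j : ℕ} (hj : j ≤ i)
    (hi : i ≤ d) :
    whitneyCoeff (hyperplanes (p :: 𝒜)) i j ≤ whitneyCoeff (hyperplanes (p' :: 𝒜)) i j := by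
  classical
  by_cases hu' : Set.univ ∈ hyperplanes (p' :: 𝒜)
  · simp [whitneyCoeff, whitneyPoly, hu', h.univ_mem_hyperplanes_cons hu']
  rw [whitneyCoeff_eq_sum_count hu' hj hi]
  by_cases hu : Set.univ ∈ hyperplanes (p :: 𝒜)
  · rw [whitneyCoeff, whitneyPoly, if_pos hu]
    simp only [Polynomial.coeff_zero, mul_zero]
    positivity
  rw [whitneyCoeff_eq_sum_count hu hj hi]
  exact_mod_cast h.sum_flatsOfDim_le i
    (fun X hX => Multiset.count_le_of_le _ (h.whitneyDims_cons_le hX))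
    fun Y hY => Multiset.count_le_of_le _ (h.whitneyDims_cons_inter_le hY)

theorem whitneyFirst_le
    (h : Specializes (hyperplanes 𝒜) (solutions p) (solutions p')) {k : ℕ} (hk : k ≤ d) :
    whitneyFirst (hyperplanes (p :: 𝒜)) k ≤ whitneyFirst (hyperplanes (p' :: 𝒜)) k := by
  rw [whitneyFirst_eq_count hk, whitneyFirst_eq_count hk]
  exact_mod_cast Multiset.count_le_of_le _
    (h.map_dim_nbcFlats_cons_le (List.Subset.refl 𝒜) (univ_mem_L _))

theorem whitneySecond_le
    (h : Specializes (hyperplanes 𝒜) (solutions p) (solutions p')) {k : ℕ} (hk : k ≤ d) :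
    whitneySecond (hyperplanes (p :: 𝒜)) k ≤ whitneySecond (hyperplanes (p' :: 𝒜)) k := by
  rw [whitneySecond_eq_card hk, whitneySecond_eq_card hk, Finset.card_eq_sum_ones,
    Finset.card_eq_sum_ones]
  exact h.sum_flatsOfDim_le (d - k) (fun _ _ => le_rfl) fun _ _ => le_rfl

end Specializes

end Comparison

section Regions

variable {d : ℕ} {𝒜 : List (Equation ℝ d)} {p : Equation ℝ d} {X : Set (Fin d → ℝ)}
  {x y : Fin d → ℝ}

/-- The side of the hyperplane `α · x = a` on which a point lies, as the sign of `α · x - a`. -/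
noncomputable def side (p : Equation ℝ d) (x : Fin d → ℝ) : SignType :=
  SignType.sign (p.1 ⬝ᵥ x - p.2)

theorem side_eq_zero_iff : side p x = 0 ↔ x ∈ solutions p := by
  rw [side, sign_eq_zero_iff, sub_eq_zero, mem_hyperplane]

theorem convex_side_eq (p : Equation ℝ d) (s : SignType) : Convex ℝ {x | side p x = s} := by
  have hmono : Monotone fun t : ℝ => SignType.sign (t - p.2) := fun t u htu =>
    SignType.sign.monotone (sub_le_sub_right htu _)
  exact (Set.ordConnected_singleton.preimage_mono hmono).convex.linear_preimage
    (dotProductEquiv ℝ (Fin d) p.1)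

theorem continuous_dotProduct_sub (p : Equation ℝ d) :
    Continuous fun x : Fin d → ℝ => p.1 ⬝ᵥ x - p.2 :=
  (continuous_const.dotProduct continuous_id).sub continuous_const

theorem continuousAt_side (hx : x ∉ solutions p) : ContinuousAt (side p) x :=
  ContinuousAt.comp (continuousAt_sign_of_ne_zero (mt sub_eq_zero.1 hx))
    (continuous_dotProduct_sub p).continuousAt

/-- The sign vector (covector) of a point with respect to a list of hyperplanes. -/
noncomputable def signVector (𝒜 : List (Equation ℝ d)) (x : Fin d → ℝ) : List SignType :=
  𝒜.map fun p => side p x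

theorem signVector_eq_iff :
    signVector 𝒜 x = signVector 𝒜 y ↔ ∀ p ∈ 𝒜, side p x = side p y :=
  List.map_inj_left

theorem convex_signVector_eq (hX : IsAffine X) (σ : List SignType) :
    Convex ℝ {x ∈ X | signVector 𝒜 x = σ} := by
  obtain ⟨t, rfl⟩ := hX
  rintro y ⟨hyX, rfl⟩ z ⟨hzX, hz⟩ a b ha hb hab
  refine ⟨t.convex hyX hzX ha hb hab, signVector_eq_iff.2 fun p hp => ?_⟩
  exact convex_side_eq p (side p y) rfl (signVector_eq_iff.1 hz p hp) ha hb hab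

theorem mem_complement_hyperplanes :
    x ∈ complement X (hyperplanes 𝒜) ↔ x ∈ X ∧ ∀ p ∈ 𝒜, x ∉ solutions p := by
  simp [complement, hyperplanes]

theorem mem_complement_hyperplanes_cons :
    x ∈ complement X (hyperplanes (p :: 𝒜)) ↔
      x ∈ complement X (hyperplanes 𝒜) ∧ x ∉ solutions p := by
  simp only [mem_complement_hyperplanes, List.forall_mem_cons]
  tauto

theorem complement_inter_solutions (p : Equation ℝ d) (𝒜 : List (Equation ℝ d))
    (X : Set (Fin d → ℝ)) :
    complement (X ∩ solutions p) (hyperplanes 𝒜) =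
      {x ∈ complement X (hyperplanes 𝒜) | side p x = 0} := by
  ext x
  simp only [mem_complement_hyperplanes, Set.mem_inter_iff, Set.mem_ofPred_eq, side_eq_zero_iff]
  tauto

theorem mem_complement_of_signVector_eq (hx : x ∈ complement X (hyperplanes 𝒜)) (hy : y ∈ X)
    (h : signVector 𝒜 y = signVector 𝒜 x) : y ∈ complement X (hyperplanes 𝒜) := by
  rw [mem_complement_hyperplanes] at hx ⊢
  refine ⟨hy, fun p hp hyp => hx.2 p hp ?_⟩
  rwa [← side_eq_zero_iff, ← signVector_eq_iff.1 h p hp, side_eq_zero_iff]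

theorem connectedComponentIn_complement_hyperplanes (hX : IsAffine X)
    (hx : x ∈ complement X (hyperplanes 𝒜)) :
    connectedComponentIn (complement X (hyperplanes 𝒜)) x =
      {y ∈ X | signVector 𝒜 y = signVector 𝒜 x} := by
  refine Set.Subset.antisymm (fun y hy => ?_) ?_
  · have hyM := connectedComponentIn_subset _ _ hy
    refine ⟨hyM.1, signVector_eq_iff.2 fun p hp => ?_⟩
    refine isPreconnected_connectedComponentIn.constant (fun z hz => ?_) hy
      (mem_connectedComponentIn hx)
    have hz := mem_complement_hyperplanes.1 (connectedComponentIn_subset _ _ hz)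
    exact (continuousAt_side (hz.2 p hp)).continuousWithinAt
  · exact (convex_signVector_eq hX _).isPreconnected.subset_connectedComponentIn ⟨hx.1, rfl⟩
      fun y hy => mem_complement_of_signVector_eq hx hy.1 hy.2

theorem encard_regions_eq_encard_signVector (hX : IsAffine X) :
    (regions X (hyperplanes 𝒜)).encard =
      (signVector 𝒜 '' complement X (hyperplanes 𝒜)).encard := by
  have himage : regions X (hyperplanes 𝒜) =
      (fun σ => {y ∈ X | signVector 𝒜 y = σ}) ''
        (signVector 𝒜 '' complement X (hyperplanes 𝒜)) := by
    ext C
    rw [Set.image_image]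
    refine exists_congr fun x => and_congr_right fun hx => ?_
    rw [connectedComponentIn_complement_hyperplanes hX hx, eq_comm]
  rw [himage, Set.InjOn.encard_image]
  rintro _ ⟨x, hx, rfl⟩ _ ⟨y, -, rfl⟩ h
  exact (h.subset ⟨hx.1, rfl⟩ : x ∈ {z ∈ X | signVector 𝒜 z = signVector 𝒜 y}).2

theorem exists_signVector_eq_and_side_eq (hX : IsAffine X) (hXp : ¬X ⊆ solutions p)
    (hx : x ∈ complement X (hyperplanes 𝒜)) (hxp : x ∈ solutions p) (s : SignType) :
    ∃ y ∈ complement X (hyperplanes 𝒜), signVector 𝒜 y = signVector 𝒜 x ∧ side p y = s := by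
  obtain ⟨w, hwX, hw⟩ := Set.not_subset.1 hXp
  have hw0 : p.1 ⬝ᵥ (w - x) ≠ 0 := by
    rwa [dotProduct_sub, mem_hyperplane.1 hxp, sub_ne_zero]
  -- `γ` is parametrized so that `α · γ ε - a` has sign `s` for every `ε > 0`
  let γ : ℝ → Fin d → ℝ := fun ε => x + (ε * s / p.1 ⬝ᵥ (w - x)) • (w - x)
  have hγ : Filter.Tendsto γ (nhdsWithin 0 (Set.Ioi 0)) (nhds x) := by
    have : Continuous γ := by fun_prop
    exact (this.tendsto' 0 x (by simp [γ])).mono_left nhdsWithin_le_nhds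
  have hside : ∀ᶠ ε in nhdsWithin 0 (Set.Ioi 0), ∀ q ∈ 𝒜, side q (γ ε) = side q x := by
    refine (List.finite_toSet 𝒜).eventually_all.2 fun q hq => ?_
    have hcont := (continuousAt_side ((mem_complement_hyperplanes.1 hx).2 q hq)).tendsto.comp hγ
    exact hcont.eventually ((isOpen_discrete {side q x}).mem_nhds rfl)
  obtain ⟨ε, hε, hε0⟩ := (hside.and self_mem_nhdsWithin).exists
  have hσ := signVector_eq_iff.2 hε
  refine ⟨γ ε, mem_complement_of_signVector_eq hx (hX.add_smul_sub_mem hx.1 hwX _) hσ, hσ, ?_⟩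
  have : p.1 ⬝ᵥ γ ε - p.2 = ε * s := by
    rw [dotProduct_add, dotProduct_smul, smul_eq_mul, div_mul_cancel₀ _ hw0,
      mem_hyperplane.1 hxp, add_sub_cancel_left]
  rw [side, this, sign_mul, sign_pos hε0, one_mul]
  cases s <;> simp

/-- The sign vectors of the points of `M(𝒜)` in `X` that lie on the side `s` of a further
hyperplane. -/
def signVectorsOn (𝒜 : List (Equation ℝ d)) (X : Set (Fin d → ℝ)) (p : Equation ℝ d)
    (s : SignType) : Set (List SignType) :=
  signVector 𝒜 '' {x ∈ complement X (hyperplanes 𝒜) | side p x = s}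

theorem signVector_cons_image (p : Equation ℝ d) (𝒜 : List (Equation ℝ d))
    (X : Set (Fin d → ℝ)) :
    signVector (p :: 𝒜) '' complement X (hyperplanes (p :: 𝒜)) =
      List.cons 1 '' signVectorsOn 𝒜 X p 1 ∪ List.cons (-1) '' signVectorsOn 𝒜 X p (-1) := by
  ext σ
  simp only [signVectorsOn, Set.image_image, Set.mem_union, Set.mem_image]
  constructor
  · rintro ⟨x, hx, rfl⟩
    rw [mem_complement_hyperplanes_cons, ← side_eq_zero_iff] at hx
    rcases h : side p x with _ | _ | _
    · exact absurd h hx.2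
    · exact .inr ⟨x, ⟨hx.1, h⟩, congrArg (List.cons · _) h.symm⟩
    · exact .inl ⟨x, ⟨hx.1, h⟩, congrArg (List.cons · _) h.symm⟩
  · rintro (⟨x, ⟨hx, h⟩, rfl⟩ | ⟨x, ⟨hx, h⟩, rfl⟩) <;>
      refine ⟨x, mem_complement_hyperplanes_cons.2 ⟨hx, ?_⟩, congrArg (List.cons · _) h⟩ <;>
      simp [← side_eq_zero_iff, h]

theorem signVectorsOn_union (hX : IsAffine X) (hXp : ¬X ⊆ solutions p) :
    signVectorsOn 𝒜 X p 1 ∪ signVectorsOn 𝒜 X p (-1) =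
      signVector 𝒜 '' complement X (hyperplanes 𝒜) := by
  refine Set.Subset.antisymm (Set.union_subset (Set.image_mono fun x hx => hx.1)
    (Set.image_mono fun x hx => hx.1)) ?_
  rintro _ ⟨x, hx, rfl⟩
  rcases h : side p x with _ | _ | _
  · obtain ⟨y, hy, hyx, hyp⟩ :=
      exists_signVector_eq_and_side_eq hX hXp hx (side_eq_zero_iff.1 h) 1
    exact .inl ⟨y, ⟨hy, hyp⟩, hyx⟩
  · exact .inr ⟨x, ⟨hx, h⟩, rfl⟩
  · exact .inl ⟨x, ⟨hx, h⟩, rfl⟩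

theorem signVectorsOn_inter (hX : IsAffine X) (hXp : ¬X ⊆ solutions p) :
    signVectorsOn 𝒜 X p 1 ∩ signVectorsOn 𝒜 X p (-1) =
      signVector 𝒜 '' complement (X ∩ solutions p) (hyperplanes 𝒜) := by
  rw [complement_inter_solutions]
  apply Set.Subset.antisymm
  · rintro _ ⟨⟨x, ⟨hx, hxp⟩, rfl⟩, z, ⟨hz, hzp⟩, hzx⟩
    have hconv := convex_signVector_eq (𝒜 := 𝒜) hX (signVector 𝒜 x)
    obtain ⟨w, ⟨hwX, hwx⟩, hw0⟩ := hconv.isPreconnected.intermediate_value ⟨hz.1, hzx⟩ ⟨hx.1, rfl⟩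
      (continuous_dotProduct_sub p).continuousOn
      ⟨(sign_eq_neg_one_iff.1 hzp).le, (sign_eq_one_iff.1 hxp).le⟩
    exact ⟨w, ⟨mem_complement_of_signVector_eq hx hwX hwx, sign_eq_zero_iff.2 hw0⟩, hwx⟩
  · rintro _ ⟨x, ⟨hx, hxp⟩, rfl⟩
    have hs : ∀ s, signVector 𝒜 x ∈ signVectorsOn 𝒜 X p s := fun s => by
      obtain ⟨y, hy, hyx, hyp⟩ :=
        exists_signVector_eq_and_side_eq hX hXp hx (side_eq_zero_iff.1 hxp) s
      exact ⟨y, ⟨hy, hyp⟩, hyx⟩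
    exact ⟨hs 1, hs (-1)⟩

theorem encard_signVector_image (hX : IsAffine X) :
    (signVector 𝒜 '' complement X (hyperplanes 𝒜)).encard = (nbcFlats 𝒜 X).card := by
  induction 𝒜 generalizing X with
  | nil =>
    have hM : complement X (hyperplanes []) = X := by ext; simp [mem_complement_hyperplanes]
    have hσ : signVector [] = fun _ : Fin d → ℝ => [] := rfl
    rw [hM, hσ]
    obtain rfl | hne := X.eq_empty_or_nonempty
    · simp [nbcFlats_empty]
    · simp [nbcFlats_nil hne, hne.image_const]
  | cons p 𝒜 ih =>
    by_cases hXp : X ⊆ solutions p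
    · have hM : complement X (hyperplanes (p :: 𝒜)) = ∅ := by
        refine Set.eq_empty_of_forall_notMem fun x hx => ?_
        exact (mem_complement_hyperplanes_cons.1 hx).2 (hXp hx.1)
      simp [hM, nbcFlats_cons_of_subset hXp]
    rw [signVector_cons_image, Set.encard_union_eq, List.cons_injective.encard_image,
      List.cons_injective.encard_image, ← Set.encard_union_add_encard_inter,
      signVectorsOn_union hX hXp, signVectorsOn_inter hX hXp, ih hX,
      ih (hX.inter (isAffine_hyperplane _ _)), nbcFlats_cons hXp, Multiset.card_add, Nat.cast_add]
    refine Set.disjoint_left.2 ?_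
    rintro _ ⟨σ, -, rfl⟩ ⟨τ, -, h⟩
    exact absurd (List.cons.inj h).1 (by decide)

theorem encard_regions (hX : IsAffine X) :
    (regions X (hyperplanes 𝒜)).encard = (nbcFlats 𝒜 X).card :=
  (encard_regions_eq_encard_signVector hX).trans (encard_signVector_image hX)

theorem regionNumber_eq_card (𝒜 : List (Equation ℝ d)) :
    regionNumber (hyperplanes 𝒜) = (nbcFlats 𝒜 Set.univ).card :=
  encard_regions isAffine_univ

theorem complement_restriction (𝒜 : List (Equation ℝ d)) (X : Set (Fin d → ℝ)) :
    complement X (restriction (hyperplanes 𝒜) X) = complement X (hyperplanes (cutting 𝒜 X)) := by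
  ext x
  rw [mem_complement_hyperplanes]
  refine and_congr_right fun hx => not_iff_comm.1 ?_
  push Not
  constructor
  · rintro ⟨p, hp, hxp⟩
    rw [mem_cutting] at hp
    exact ⟨_, ⟨_, ⟨solutions_mem_hyperplanes hp.1, fun h => hp.2 h.2⟩, rfl, x, hxp, hx⟩, hxp, hx⟩
  · rintro ⟨_, ⟨_, ⟨⟨p, hp, rfl⟩, hpX⟩, rfl, -⟩, hxp, -⟩
    exact ⟨p, mem_cutting.2 ⟨hp, fun h => hpX ⟨⟨p, hp, rfl⟩, h⟩⟩, hxp⟩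

theorem disjoint_regions_restriction {𝒜 : Set (Set (Fin d → ℝ))} {Y : Set (Fin d → ℝ)}
    (hX : X ∈ L 𝒜) (hY : Y ∈ L 𝒜) (hne : X ≠ Y) :
    Disjoint (regions X (restriction 𝒜 X)) (regions Y (restriction 𝒜 Y)) := by
  refine Set.disjoint_left.2 ?_
  rintro _ ⟨x, hx, rfl⟩ ⟨y, -, h⟩
  have hxY : x ∈ complement Y (restriction 𝒜 Y) :=
    connectedComponentIn_subset _ y (h ▸ mem_connectedComponentIn hx)
  exact hne (IsStratum.unique ⟨hX, hx⟩ ⟨hY, hxY⟩)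

theorem faceNumber_eq_sum_card (𝒜 : List (Equation ℝ d)) (k : ℕ) :
    faceNumber (hyperplanes 𝒜) k =
      ∑ X ∈ flatsOfDim (hyperplanes 𝒜) k, (whitneyDims 𝒜 X).card := by
  have hfaces : faces (hyperplanes 𝒜) k =
      ⋃ X ∈ (flatsOfDim (hyperplanes 𝒜) k : Set (Set (Fin d → ℝ))),
        regions X (restriction (hyperplanes 𝒜) X) := by
    ext C
    simp [faces, mem_flatsOfDim, and_assoc]
  rw [faceNumber, hfaces, (Finset.finite_toSet _).encard_biUnion, finsum_mem_coe_finset]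
  · push_cast
    refine Finset.sum_congr rfl fun X hX => ?_
    have hXaff := IsAffine.of_mem_L_hyperplanes (mem_flatsOfDim.1 hX).1
    rw [whitneyDims, Multiset.card_map, ← encard_regions hXaff, regions, complement_restriction,
      regions]
  · exact fun X hX Y hY => disjoint_regions_restriction (mem_flatsOfDim.1 hX).1
      (mem_flatsOfDim.1 hY).1

end Regions

namespace Specializes

variable {d : ℕ} {𝒜 : List (Equation ℝ d)} {p p' : Equation ℝ d}

theorem faceNumber_le (h : Specializes (hyperplanes 𝒜) (solutions p) (solutions p')) (k : ℕ) :
    faceNumber (hyperplanes (p :: 𝒜)) k ≤ faceNumber (hyperplanes (p' :: 𝒜)) k := by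
  rw [faceNumber_eq_sum_card, faceNumber_eq_sum_card]
  exact_mod_cast h.sum_flatsOfDim_le k
    (fun X hX => Multiset.card_le_card (h.whitneyDims_cons_le hX))
    fun Y hY => Multiset.card_le_card (h.whitneyDims_cons_inter_le hY)

theorem regionNumber_le (h : Specializes (hyperplanes 𝒜) (solutions p) (solutions p')) :
    regionNumber (hyperplanes (p :: 𝒜)) ≤ regionNumber (hyperplanes (p' :: 𝒜)) := by
  rw [regionNumber_eq_card, regionNumber_eq_card, ← Multiset.card_map dim,
    ← Multiset.card_map dim]
  exact_mod_cast Multiset.card_le_card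
    (h.map_dim_nbcFlats_cons_le (List.Subset.refl 𝒜) (univ_mem_L _))

end Specializes

section Equations

variable {F : Type*} {d m : ℕ} {β : Fin m → Fin d → F} {b : Fin m → F}

/-- The list of defining equations of the arrangement `{H_{β_i,b_i}}`. -/
def equations (β : Fin m → Fin d → F) (b : Fin m → F) : List (Equation F d) :=
  List.ofFn fun i => (β i, b i)

theorem mem_equations {p : Equation F d} : p ∈ equations β b ↔ ∃ i, (β i, b i) = p := by
  rw [equations, List.mem_ofFn]

end Equations

section Adjoint

variable {F : Type*} [Field F] {d m : ℕ} {𝒜 : List (Equation F d)} {β : Fin m → Fin d → F}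
  {b : Fin m → F} {X : Set (Fin d → F)} {α α' u w : Fin d → F} {a a' : F}

theorem exists_dotProduct_ne_zero {s : Set (Fin d → F)} (hs : Submodule.span F s = ⊤)
    (hw : w ≠ 0) : ∃ α ∈ s, α ⬝ᵥ w ≠ 0 := by
  by_contra! h
  refine hw ((dotProductEquiv F (Fin d)).map_eq_zero_iff.1 (LinearMap.ext_on hs fun α hα => ?_))
  simpa [dotProduct_comm] using h α hα

theorem exists_singleton_mem_L (h𝒜 : ∀ w ≠ 0, ∃ p ∈ 𝒜, p.1 ⬝ᵥ w ≠ 0)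
    (hX : X ∈ L (hyperplanes 𝒜)) : ∃ v ∈ X, {v} ∈ L (hyperplanes 𝒜) := by
  obtain ⟨Y, hYX, hY⟩ := (Set.toFinite (L (hyperplanes 𝒜))).exists_le_minimal hX
  obtain ⟨v, hv⟩ := hY.prop.1
  suffices Y = {v} from ⟨v, hYX hv, this ▸ hY.prop⟩
  refine Set.eq_singleton_iff_unique_mem.2 ⟨hv, fun w hw => ?_⟩
  by_contra hwv
  obtain ⟨p, hp, hpw⟩ := h𝒜 _ (sub_ne_zero.2 hwv)
  rw [dotProduct_sub, sub_ne_zero] at hpw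
  have hYp : Y ∩ solutions p ∈ L (hyperplanes 𝒜) :=
    inter_mem_L hY.prop (solutions_mem_hyperplanes hp)
      ((IsAffine.of_mem_L_hyperplanes hY.prop).inter_hyperplane_nonempty hw hv hpw p.2)
  have hsub : Y ⊆ solutions p :=
    (hY.le_of_le hYp Set.inter_subset_left).trans Set.inter_subset_right
  exact hpw ((hsub hw).trans (hsub hv).symm)

theorem span_singleton_mem_L (h𝒜 : ∀ p ∈ 𝒜, p.2 = 0) (hαu : α ⬝ᵥ u = 1)
    (hu : {u} ∈ L (hyperplanes ((α, 1) :: 𝒜))) :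
    (Submodule.span F {u} : Set (Fin d → F)) ∈ L (hyperplanes 𝒜) := by
  have hspan : (Submodule.span F {u} : Set (Fin d → F)) =
      ⋂₀ localization (hyperplanes 𝒜) {u} := by
    refine Set.Subset.antisymm (Set.subset_sInter ?_) fun y hy => ?_
    · rintro _ ⟨⟨p, hp, rfl⟩, hup⟩ y hy
      obtain ⟨c, rfl⟩ := Submodule.mem_span_singleton.1 hy
      rw [Set.singleton_subset_iff, mem_hyperplane, h𝒜 p hp] at hup
      rw [mem_hyperplane, h𝒜 p hp, dotProduct_smul, hup, smul_zero]
    · -- moving `y` along `u` into the slice `α = 1` lands on its only point, which is `u`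
      have hy' : {y + (1 - α ⬝ᵥ y) • u} ⊆ ({u} : Set (Fin d → F)) := by
        refine subset_of_mem_L hu ?_
        rw [hyperplanes_cons]
        rintro _ (rfl | ⟨p, hp, rfl⟩) hup
        · simp [mem_hyperplane, hαu]
        · have hyp := hy _ ⟨solutions_mem_hyperplanes hp, hup⟩
          rw [Set.singleton_subset_iff, mem_hyperplane, h𝒜 p hp] at hup
          rw [mem_hyperplane, h𝒜 p hp] at hyp
          simp [mem_hyperplane, hup, hyp, h𝒜 p hp]
      have hyu : y + (1 - α ⬝ᵥ y) • u = u := by simpa using hy'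
      refine Submodule.mem_span_singleton.2 ⟨α ⬝ᵥ y, ?_⟩
      linear_combination (norm := module) -hyu
  rw [hspan]
  exact sInter_localization_mem_L _ (Set.singleton_nonempty u)

theorem exists_span_singleton_mem_L (h𝒜 : ∀ p ∈ 𝒜, p.2 = 0)
    (hess : ∀ w ≠ 0, ∃ p ∈ 𝒜, p.1 ⬝ᵥ w ≠ 0) (hαw : α ⬝ᵥ w ≠ 0) :
    ∃ u, α ⬝ᵥ u ≠ 0 ∧ (Submodule.span F {u} : Set (Fin d → F)) ∈ L (hyperplanes 𝒜) ∧
      ∀ p ∈ 𝒜, p.1 ⬝ᵥ w = 0 → p.1 ⬝ᵥ u = 0 := by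
  set w' := (α ⬝ᵥ w)⁻¹ • w with hw'
  have hαw' : α ⬝ᵥ w' = 1 := by rw [hw', dotProduct_smul, smul_eq_mul, inv_mul_cancel₀ hαw]
  obtain ⟨u, huw, hu⟩ := exists_singleton_mem_L (𝒜 := (α, 1) :: 𝒜)
    (fun z hz => (hess z hz).imp fun p hp => hp.imp_left (List.mem_cons_of_mem _))
    (sInter_localization_mem_L _ (Set.singleton_nonempty w'))
  have hmem : ∀ p ∈ (α, 1) :: 𝒜, w' ∈ solutions p → u ∈ solutions p := fun p hp hw'p =>
    huw _ ⟨solutions_mem_hyperplanes hp, Set.singleton_subset_iff.2 hw'p⟩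
  have hαu : α ⬝ᵥ u = 1 := hmem _ List.mem_cons_self hαw'
  refine ⟨u, hαu ▸ one_ne_zero, span_singleton_mem_L h𝒜 hαu hu, fun p hp hpw => ?_⟩
  have hpu := hmem p (List.mem_cons_of_mem _ hp)
  rw [mem_hyperplane, mem_hyperplane, h𝒜 p hp] at hpu
  exact hpu (by rw [hw', dotProduct_smul, hpw, smul_zero])

theorem hyperplanes_equations (β : Fin m → Fin d → F) (b : Fin m → F) :
    hyperplanes (equations β b) = arrangement β b := by
  ext H
  simp [hyperplanes, mem_equations]

theorem extension_arrangement (β : Fin m → Fin d → F) (b : Fin m → F) (α : Fin d → F) (a : F) :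
    extension (arrangement β b) α a = hyperplanes ((α, a) :: equations β b) := by
  rw [hyperplanes_cons, hyperplanes_equations]

theorem exists_mem_equations_dotProduct_ne_zero (hβ : Submodule.span F (Set.range β) = ⊤)
    (b : Fin m → F) (w : Fin d → F) (hw : w ≠ 0) : ∃ p ∈ equations β b, p.1 ⬝ᵥ w ≠ 0 := by
  obtain ⟨_, ⟨i, rfl⟩, hi⟩ := exists_dotProduct_ne_zero hβ hw
  exact ⟨_, mem_equations.2 ⟨i, rfl⟩, hi⟩

theorem snoc_mem_hyperplane_snoc {v : Fin d → F} {c : F} :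
    (Fin.snoc α a : Fin (d + 1) → F) ∈ hyperplane (Fin.snoc v c : Fin (d + 1) → F) 0 ↔
      α ⬝ᵥ v + c * a = 0 := by
  rw [mem_hyperplane, dotProduct_comm α v]
  simp [dotProduct, Fin.sum_univ_castSucc]

section Strata

variable {S S' : Set (Fin (d + 1) → F)}

theorem mem_hyperplane_of_isStratum
    (hS : IsStratum (inducedAdjoint β b) (Fin.snoc α a : Fin (d + 1) → F) S)
    (hS' : IsStratum (inducedAdjoint β b) (Fin.snoc α' a' : Fin (d + 1) → F) S') (hSS' : S ⊆ S')
    {v : Fin d → F} (hv : {v} ∈ L (arrangement β b)) (h : v ∈ hyperplane α' a') :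
    v ∈ hyperplane α a := by
  have hmem := hS'.subset_of_mem (.inl ⟨v, hv, rfl⟩)
    (snoc_mem_hyperplane_snoc.2 (by rw [mem_hyperplane.1 h]; ring)) (hSS' hS.2.1)
  rw [snoc_mem_hyperplane_snoc] at hmem
  rw [mem_hyperplane]
  linear_combination hmem

theorem dotProduct_eq_zero_of_isStratum
    (hS : IsStratum (inducedAdjoint β b) (Fin.snoc α a : Fin (d + 1) → F) S)
    (hS' : IsStratum (inducedAdjoint β b) (Fin.snoc α' a' : Fin (d + 1) → F) S') (hSS' : S ⊆ S')
    (hu : (Submodule.span F {u} : Set (Fin d → F)) ∈ L (arrangement β 0)) (h : α' ⬝ᵥ u = 0) :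
    α ⬝ᵥ u = 0 := by
  obtain rfl | hu0 := eq_or_ne u 0
  · exact dotProduct_zero α
  have hmem := hS'.subset_of_mem (.inr ⟨u, hu0, hu, rfl⟩)
    (snoc_mem_hyperplane_snoc.2 (by rw [h]; ring)) (hSS' hS.2.1)
  rw [snoc_mem_hyperplane_snoc] at hmem
  linear_combination hmem

theorem exists_dotProduct_ne_of_isStratum (hβ : Submodule.span F (Set.range β) = ⊤)
    (hS : IsStratum (inducedAdjoint β b) (Fin.snoc α a : Fin (d + 1) → F) S)
    (hS' : IsStratum (inducedAdjoint β b) (Fin.snoc α' a' : Fin (d + 1) → F) S') (hSS' : S ⊆ S')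
    (hX : X ∈ L (arrangement β b)) {x y : Fin d → F} (hx : x ∈ X) (hy : y ∈ X)
    (hxy : α ⬝ᵥ x ≠ α ⬝ᵥ y) : ∃ z ∈ X, α' ⬝ᵥ x ≠ α' ⬝ᵥ z := by
  obtain ⟨u, hαu, hu, huyx⟩ := exists_span_singleton_mem_L (𝒜 := equations β 0) (w := y - x)
    (fun p hp => by obtain ⟨i, rfl⟩ := mem_equations.1 hp; rfl)
    (exists_mem_equations_dotProduct_ne_zero hβ 0)
    (by rwa [dotProduct_sub, sub_ne_zero, ne_comm])
  rw [hyperplanes_equations] at hu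
  have hxu : {x + u} ⊆ X := by
    refine subset_of_mem_L hX ?_
    rintro _ ⟨i, rfl⟩ hXi
    have hiu : β i ⬝ᵥ u = 0 := huyx (β i, 0) (mem_equations.2 ⟨i, rfl⟩)
      (by rw [dotProduct_sub, mem_hyperplane.1 (hXi hx), mem_hyperplane.1 (hXi hy), sub_self])
    rw [Set.singleton_subset_iff, mem_hyperplane, dotProduct_add, mem_hyperplane.1 (hXi hx), hiu,
      add_zero]
  refine ⟨x + u, hxu rfl, fun h => hαu (dotProduct_eq_zero_of_isStratum hS hS' hSS' hu ?_)⟩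
  rwa [dotProduct_add, left_eq_add] at h

theorem specializes_of_isStratum (hβ : Submodule.span F (Set.range β) = ⊤)
    (hS : IsStratum (inducedAdjoint β b) (Fin.snoc α a : Fin (d + 1) → F) S)
    (hS' : IsStratum (inducedAdjoint β b) (Fin.snoc α' a' : Fin (d + 1) → F) S') (hSS' : S ⊆ S') :
    Specializes (arrangement β b) (hyperplane α a) (hyperplane α' a') where
  subset X hX hX' := by
    obtain ⟨v, hvX, hv⟩ : ∃ v ∈ X, {v} ∈ L (arrangement β b) := by
      rw [← hyperplanes_equations] at hX ⊢
      exact exists_singleton_mem_L (exists_mem_equations_dotProduct_ne_zero hβ b) hX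
    have hvα : α ⬝ᵥ v = a := mem_hyperplane_of_isStratum hS hS' hSS' hv (hX' hvX)
    intro x hx
    by_contra hxα
    obtain ⟨z, hz, hvz⟩ := exists_dotProduct_ne_of_isStratum hβ hS hS' hSS' hX hvX hx
      fun h => hxα (h.symm.trans hvα)
    exact hvz ((hX' hvX).trans (hX' hz).symm)
  nonempty X hX hXα := by
    rintro ⟨x, hx, hxα⟩
    obtain ⟨y, hy, hyα⟩ := Set.not_subset.1 hXα
    obtain ⟨z, hz, hxz⟩ := exists_dotProduct_ne_of_isStratum hβ hS hS' hSS' hX hx hy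
      fun h => hyα (h.symm.trans hxα)
    rw [← hyperplanes_equations] at hX
    exact (IsAffine.of_mem_L_hyperplanes hX).inter_hyperplane_nonempty hx hz hxz a'

end Strata

end Adjoint

end HypArr

theorem theorem2p2 :
    (∀ (F : Type*) [Field F] (d m : ℕ) (β : Fin m → Fin d → F) (b : Fin m → F),
      (∀ i, β i ≠ 0) → Submodule.span F (Set.range β) = ⊤ →
      ∀ (α α' : Fin d → F) (a a' : F) (X X' : Set (Fin (d + 1) → F)),
      HypArr.IsStratum (HypArr.inducedAdjoint β b) (Fin.snoc α a : Fin (d + 1) → F) X →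
      HypArr.IsStratum (HypArr.inducedAdjoint β b) (Fin.snoc α' a' : Fin (d + 1) → F) X' →
      X ⊆ X' →
      (∀ i j, j ≤ i → i ≤ d →
        HypArr.whitneyCoeff (HypArr.extension (HypArr.arrangement β b) α a) i j ≤
          HypArr.whitneyCoeff (HypArr.extension (HypArr.arrangement β b) α' a') i j) ∧
      (∀ i, i ≤ d →
        HypArr.whitneyFirst (HypArr.extension (HypArr.arrangement β b) α a) i ≤
          HypArr.whitneyFirst (HypArr.extension (HypArr.arrangement β b) α' a') i) ∧
      (∀ i, i ≤ d →
        HypArr.whitneySecond (HypArr.extension (HypArr.arrangement β b) α a) i ≤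
          HypArr.whitneySecond (HypArr.extension (HypArr.arrangement β b) α' a') i)) ∧
    (∀ (d m : ℕ) (β : Fin m → Fin d → ℝ) (b : Fin m → ℝ),
      (∀ i, β i ≠ 0) → Submodule.span ℝ (Set.range β) = ⊤ →
      ∀ (α α' : Fin d → ℝ) (a a' : ℝ) (X X' : Set (Fin (d + 1) → ℝ)),
      HypArr.IsStratum (HypArr.inducedAdjoint β b) (Fin.snoc α a : Fin (d + 1) → ℝ) X →
      HypArr.IsStratum (HypArr.inducedAdjoint β b) (Fin.snoc α' a' : Fin (d + 1) → ℝ) X' →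
      X ⊆ X' →
      (∀ i, i ≤ d →
        HypArr.faceNumber (HypArr.extension (HypArr.arrangement β b) α a) i ≤
          HypArr.faceNumber (HypArr.extension (HypArr.arrangement β b) α' a') i) ∧
      HypArr.regionNumber (HypArr.extension (HypArr.arrangement β b) α a) ≤
        HypArr.regionNumber (HypArr.extension (HypArr.arrangement β b) α' a')) := by
  constructor
  · intro F _ d m β b _ hβ α α' a a' X X' hX hX' hXX'
    have h := HypArr.specializes_of_isStratum hβ hX hX' hXX'
    rw [← HypArr.hyperplanes_equations] at h
    simp only [HypArr.extension_arrangement]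
    exact ⟨fun i j hj hi => h.whitneyCoeff_le (p := (α, a)) (p' := (α', a')) hj hi,
      fun i hi => h.whitneyFirst_le (p := (α, a)) (p' := (α', a')) hi,
      fun i hi => h.whitneySecond_le (p := (α, a)) (p' := (α', a')) hi⟩
  · intro d m β b _ hβ α α' a a' X X' hX hX' hXX'
    have h := HypArr.specializes_of_isStratum hβ hX hX' hXX'
    rw [← HypArr.hyperplanes_equations] at h
    simp only [HypArr.extension_arrangement]
    exact ⟨fun i _ => h.faceNumber_le (p := (α, a)) (p' := (α', a')) i,
      h.regionNumber_le (p := (α, a)) (p' := (α', a'))⟩
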